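/- Consider $n$ bosonic modes with canonical operators $r=(x_1,\dots,x_n,p_1,\dots,p_n)$, $x_i=(a_i+a_i^\dagger)/\sqrt2$, $p_i=\mathrm i(a_i^\dagger-a_i)/\sqrt2$, and symplectic form $\Omega=\begin{pmatrix}0&\mathbb I\\-\mathbb I&0\end{pmatrix}$. Let $S\in\mathrm{Sp}(2n,\mathbb R)$, let $\mathcal U_S$ be a Gaussian unitary specified by $S$ (that is, $\mathcal U_S^\dagger r_i\,\mathcal U_S=\sum_j S_{ij}r_j$), and let $|\mathbf f\rangle$, $\mathbf f=(f_1,\dots,f_n)$, be a Fock state. Put $f_{\max}=\max_i f_i$, define $s$ by letting $\mathrm e^{s}$ be the largest singular value of $S$, and let $\|\cdot\|$ be the operator norm. Let $M=\big(\mathrm{Re}\,\langle\psi|r_ir_j|\psi\rangle\big)_{i,j=1}^{2n}$ be the covariance matrix of $|\psi\rangle=\mathcal U_S|\mathbf f\rangle$. Let $0\le\varepsilon<1/4$, let $F$ be a real $2n\times2n$ matrix with $\|F\|\le1$, and suppose that $M'=M+\varepsilon F$ is a covariance matrix, i.e. $M'$ is real symmetric and $M'+\tfrac{\mathrm i}{2}\Omega\ge0$.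 Let $R'\in\mathrm{Sp}(2n,\mathbb R)$ symplectically diagonalize $M'$, i.e. $M'=R'\,\mathrm{diag}(D',D')\,R'^{T}$ for a real diagonal $n\times n$ matrix $D'$. Then $$\min_{O\in\mathrm{Sp}(2n,\mathbb R)\cap\mathrm O(2n)}\big\|R'^{-1}S-O\big\|\;\le\;\delta=24\,\varepsilon^{1/8}\,\mathrm e^{21s/4}\,n^{3/2}\,(1+f_{\max})^{3/2}.$$ -/

import Mathlib

open scoped Matrix.Norms.L2Operator ComplexOrder

noncomputable section

namespace Bosonic

/-- Labels of the `2n` canonical operators: `Sum.inl i` is the position `x_i`,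
`Sum.inr i` is the momentum `p_i`. -/
abbrev Idx (n : ℕ) : Type := Fin n ⊕ Fin n

/-- The Hilbert space of `n` bosonic modes in the occupation-number representation:
square-summable amplitudes indexed by the occupation numbers. -/
abbrev FockSpace (n : ℕ) : Type := lp (fun _ : Fin n → ℕ => ℂ) 2

/-- The Fock state `|f⟩`. -/
def fock {n : ℕ} (f : Fin n → ℕ) : FockSpace n := lp.single 2 f (1 : ℂ)

/-- The annihilation operator `a_i`, acting on sequences of amplitudes:
`a_i |m⟩ = √(m_i) |m - e_i⟩`. -/
def annihilation {n : ℕ} (i : Fin n) (ψ : (Fin n → ℕ) → ℂ) : (Fin n → ℕ) → ℂ :=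
  fun m => (Real.sqrt ((m i : ℝ) + 1) : ℂ) * ψ (m + Pi.single i 1)

/-- The creation operator `a_i†`, acting on sequences of amplitudes:
`a_i† |m⟩ = √(m_i + 1) |m + e_i⟩` (the prefactor vanishes where `m i = 0`). -/
def creation {n : ℕ} (i : Fin n) (ψ : (Fin n → ℕ) → ℂ) : (Fin n → ℕ) → ℂ :=
  fun m => (Real.sqrt (m i : ℝ) : ℂ) * ψ (m - Pi.single i 1)

/-- The canonical operators `r = (x_1, …, x_n, p_1, …, p_n)` with
`x = (a + a†) / √2` and `p = i (a† - a) / √2`, acting on sequences of amplitudes.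
The unbounded operator `r_j` on `FockSpace n` is the restriction to those square-summable `ψ`
for which `quadrature j ψ` is square-summable. -/
def quadrature {n : ℕ} (j : Idx n) (ψ : (Fin n → ℕ) → ℂ) : (Fin n → ℕ) → ℂ :=
  match j with
  | Sum.inl i => fun m => (annihilation i ψ m + creation i ψ m) / (Real.sqrt 2 : ℂ)
  | Sum.inr i => fun m =>
      Complex.I * (creation i ψ m - annihilation i ψ m) / (Real.sqrt 2 : ℂ)

/-- `U` is a Gaussian unitary `𝒰_S` (without displacement) specified by the matrix `S`:
`U† r_i U = ∑ j, S i j r_j`, as an identity of operators on the common domain of the `r_j`.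
For symplectic `S` this determines `U` up to a global phase. -/
def IsGaussianUnitary {n : ℕ} (S : Matrix (Idx n) (Idx n) ℝ)
    (U : FockSpace n ≃ₗᵢ[ℂ] FockSpace n) : Prop :=
  ∀ (ψ : FockSpace n) (φ : Idx n → FockSpace n),
    (∀ j, (φ j : (Fin n → ℕ) → ℂ) = quadrature j ψ) →
    ∀ i, quadrature i (U ψ) = U (∑ j, (S i j : ℂ) • φ j)

/-- The second moments `Λ i j = ⟨ψ| r_i r_j |ψ⟩`. -/
def momentMatrix {n : ℕ} (ψ : FockSpace n) : Matrix (Idx n) (Idx n) ℂ :=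
  Matrix.of fun i j => ∑' m, star (ψ m) * quadrature i (quadrature j ψ) m

/-- The covariance matrix `Re ⟨ψ| r_i r_j |ψ⟩` of a state with vanishing first moments. -/
def covarianceMatrix {n : ℕ} (ψ : FockSpace n) : Matrix (Idx n) (Idx n) ℝ :=
  (momentMatrix ψ).map Complex.re

/-- The symplectic form `Ω = [[0, 1], [-1, 0]]`. -/
def Omega (n : ℕ) : Matrix (Idx n) (Idx n) ℝ := Matrix.fromBlocks 0 1 (-1) 0

/-- `V` is a (bona fide quantum) covariance matrix: real symmetric and obeying the
uncertainty relation `V + (i/2) Ω ≥ 0`. -/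
def IsQuantumCovariance {n : ℕ} (V : Matrix (Idx n) (Idx n) ℝ) : Prop :=
  V.IsSymm ∧
    (V.map Complex.ofReal + (Complex.I / 2) • (Omega n).map Complex.ofReal).PosSemidef

/-- `R` symplectically diagonalizes `V`: `R` is symplectic and `V = R diag(D, D) Rᵀ`. -/
def SymplecticallyDiagonalizes {n : ℕ} (R V : Matrix (Idx n) (Idx n) ℝ) : Prop :=
  R ∈ Matrix.symplecticGroup (Fin n) ℝ ∧
    ∃ D : Fin n → ℝ, V = R * Matrix.diagonal (Sum.elim D D) * R.transpose

/-- The maximum squeezing `s` of `S`: `exp s` is the largest singular value of `S`. -/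
def maxSqueezing {n : ℕ} (S : Matrix (Idx n) (Idx n) ℝ) : ℝ :=
  Real.log ((Matrix.toEuclideanLin S).singularValues 0)

/-- The largest occupation number `max_i f_i`. -/
def maxOccupation {n : ℕ} (f : Fin n → ℕ) : ℕ := Finset.univ.sup f

end Bosonic

end

/-! In the Heisenberg picture the covariance matrix is `M = S Δ Sᵀ`, with `Δ` diagonal with entries
`f i + 1/2`. For `T = R'⁻¹ S`, the relation `M' = R' Δ' R'ᵀ` becomes `T Δ Tᵀ = Δ' + E`, where `E` is
`-ε F` conjugated by `R'⁻¹`, hence small. If `E` vanished, symplecticity would give `T Δ² = Δ'² T`,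
so `T Δ = Δ' T` by positivity, and then `T Tᵀ = 1`.

The argument is stable. Symplectic eigenvalues are at least `1/2`, so `T Δ - Δ' T` is dominated
entrywise by the defect in the squared relation (`l2_opNorm_intertwiner_le`), and dividing by `Δ'`
bounds `T Tᵀ - 1` (`l2_opNorm_mul_transpose_sub_one_le`). No spectral gap is needed. The orthogonal
polar factor of `T` is symplectic and at least as close to `T` as `T Tᵀ` is to the identity
(`exists_orthogonal_symplectic_near`).

This estimate is linear in `ε` but has large powers of the norms. When `ε^(1/8)` is small compared
with those norms, seven of its eight powers absorb them; otherwise the claimed bound is so large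
that the identity serves as `O`. -/

namespace Bosonic

/-! ### Second moments of Fock states under Gaussian unitaries. -/

section FockMoments

variable {n : ℕ}

lemma annihilation_linear (i : Fin n) (c d : ℂ) (ψ φ : (Fin n → ℕ) → ℂ) (m : Fin n → ℕ) :
    annihilation i (fun k => c * ψ k + d * φ k) m =
      c * annihilation i ψ m + d * annihilation i φ m := by
  simp only [annihilation]; ring

lemma creation_linear (i : Fin n) (c d : ℂ) (ψ φ : (Fin n → ℕ) → ℂ) (m : Fin n → ℕ) :
    creation i (fun k => c * ψ k + d * φ k) m =
      c * creation i ψ m + d * creation i φ m := by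
  simp only [creation]; ring

lemma quadrature_sum_smul {ι : Type*} (s : Finset ι) (j : Idx n) (c : ι → ℂ)
    (ψ : ι → (Fin n → ℕ) → ℂ) (m : Fin n → ℕ) :
    quadrature j (∑ k ∈ s, c k • ψ k) m = ∑ k ∈ s, c k * quadrature j (ψ k) m := by
  rcases j with i | i
  · simp only [quadrature, annihilation, creation, Finset.sum_apply, Pi.smul_apply, smul_eq_mul,
      Finset.mul_sum, ← Finset.sum_add_distrib, Finset.sum_div]
    exact Finset.sum_congr rfl fun k _ => by ring
  · simp only [quadrature, annihilation, creation, Finset.sum_apply, Pi.smul_apply, smul_eq_mul,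
      Finset.mul_sum, ← Finset.sum_sub_distrib, Finset.sum_div]
    exact Finset.sum_congr rfl fun k _ => by ring

lemma finite_support_annihilation (i : Fin n) {ψ : (Fin n → ℕ) → ℂ}
    (h : ψ.support.Finite) : (annihilation i ψ).support.Finite := by
  refine (h.preimage (f := fun m => m + Pi.single i 1)
    (add_left_injective _).injOn).subset fun m hm => ?_
  simp only [Function.mem_support, annihilation] at hm
  exact right_ne_zero_of_mul hm

lemma sub_single_add_single {m : Fin n → ℕ} {i : Fin n} (h : m i ≠ 0) :
    m - Pi.single i 1 + Pi.single i 1 = m := by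
  refine tsub_add_cancel_of_le fun k => ?_
  by_cases hk : k = i
  · subst hk; simpa using Nat.one_le_iff_ne_zero.mpr h
  · simp [hk]

lemma finite_support_creation (i : Fin n) {ψ : (Fin n → ℕ) → ℂ}
    (h : ψ.support.Finite) : (creation i ψ).support.Finite := by
  refine (h.image (fun m => m + Pi.single i 1)).subset fun m hm => ?_
  simp only [Function.mem_support, creation] at hm
  refine ⟨m - Pi.single i 1, right_ne_zero_of_mul hm, sub_single_add_single fun h0 => ?_⟩
  simp [h0] at hm

lemma finite_support_quadrature (j : Idx n) {ψ : (Fin n → ℕ) → ℂ}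
    (h : ψ.support.Finite) : (quadrature j ψ).support.Finite := by
  rcases j with i | i
  all_goals
    refine ((finite_support_annihilation i h).union (finite_support_creation i h)).subset
      fun m hm => ?_
    by_contra hc
    simp only [Set.mem_union, Function.mem_support, not_or, not_not] at hc
    simp [quadrature, hc.1, hc.2] at hm

/-- A finitely supported sequence of amplitudes, as a vector of the Fock space. -/
def ofFiniteSupport (ψ : (Fin n → ℕ) → ℂ) (h : ψ.support.Finite) : FockSpace n :=
  ⟨ψ, (memℓp_zero h).of_exponent_ge zero_le⟩

lemma coe_ofFiniteSupport (ψ : (Fin n → ℕ) → ℂ) (h : ψ.support.Finite) :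
    (ofFiniteSupport ψ h : (Fin n → ℕ) → ℂ) = ψ := rfl

/-- Heisenberg picture for the second moments of a Gaussian unitary applied to a Fock state. -/
lemma momentMatrix_gaussian {S : Matrix (Idx n) (Idx n) ℝ} {U : FockSpace n ≃ₗᵢ[ℂ] FockSpace n}
    (hU : IsGaussianUnitary S U) (f : Fin n → ℕ) (i j : Idx n) :
    momentMatrix (U (fock f)) i j =
      ∑ l, (S i l : ℂ) * ∑ k, (S j k : ℂ) *
        quadrature l (quadrature k (Pi.single f (1 : ℂ))) f := by
  have hf : (Pi.single f (1 : ℂ) : (Fin n → ℕ) → ℂ).support.Finite :=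
    (Set.finite_singleton f).subset Pi.support_single_subset
  -- Finite support keeps every vector in the domain of the quadratures, so the intertwining
  -- relation can be used twice, first on `fock f` and then on the resulting combination.
  set φ : Idx n → FockSpace n := fun k =>
    ofFiniteSupport _ (finite_support_quadrature k hf) with hφ
  have h1 := hU (fock f) φ (fun _ => rfl) j
  have hcoe : ((∑ k, (S j k : ℂ) • φ k : FockSpace n) : (Fin n → ℕ) → ℂ) =
      ∑ k, (S j k : ℂ) • quadrature k (Pi.single f (1 : ℂ)) := by
    rw [lp.coeFn_sum]; rfl
  have hfin : ((∑ k, (S j k : ℂ) • φ k : FockSpace n) : (Fin n → ℕ) → ℂ).support.Finite := by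
    rw [hcoe]
    refine (Set.finite_iUnion fun k => finite_support_quadrature k hf).subset fun m hm => ?_
    by_contra hc
    simp only [Set.mem_iUnion, Function.mem_support, not_exists, not_not] at hc
    simp [Finset.sum_apply, hc] at hm
  set φ' : Idx n → FockSpace n := fun l =>
    ofFiniteSupport _ (finite_support_quadrature l hfin) with hφ'
  have h2 := hU (∑ k, (S j k : ℂ) • φ k) φ' (fun _ => rfl) i
  have h3 : momentMatrix (U (fock f)) i j =
      inner ℂ (U (fock f)) (U (∑ l, (S i l : ℂ) • φ' l)) := by
    rw [lp.inner_eq_tsum]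
    simp only [momentMatrix, Matrix.of_apply, h1, h2]
    exact tsum_congr fun m => mul_comm _ _
  rw [h3, LinearIsometryEquiv.inner_map_map, fock, lp.inner_single_left, lp.coeFn_sum]
  simp only [Finset.sum_apply, lp.coeFn_smul, Pi.smul_apply, smul_eq_mul, RCLike.inner_apply,
    map_one, mul_one]
  refine Finset.sum_congr rfl fun l _ => ?_
  rw [hφ', coe_ofFiniteSupport, hcoe, quadrature_sum_smul]

lemma annihilation_annihilation_single (f : Fin n → ℕ) (i j : Fin n) :
    annihilation i (annihilation j (Pi.single f (1 : ℂ))) f = 0 := by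
  have : f + Pi.single i 1 + Pi.single j 1 ≠ f := fun h => by
    have := congrFun h i; simp at this; omega
  simp [annihilation, Pi.single_eq_of_ne this]

lemma creation_creation_single (f : Fin n → ℕ) (i j : Fin n) :
    creation i (creation j (Pi.single f (1 : ℂ))) f = 0 := by
  -- At `f i = 0` truncated subtraction leaves `f i` unchanged, so occupation numbers cannot
  -- separate the two states; the vanishing prefactor settles this case.
  by_cases h0 : f i = 0
  · simp [creation, h0]
  have : f - Pi.single i 1 - Pi.single j 1 ≠ f := fun h => by
    have := congrFun h i; simp at this; omega
  simp [creation, Pi.single_eq_of_ne this]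

lemma annihilation_creation_single (f : Fin n → ℕ) (i j : Fin n) :
    annihilation i (creation j (Pi.single f (1 : ℂ))) f = if i = j then (f i : ℂ) + 1 else 0 := by
  split_ifs with hij
  · subst hij
    have h : f + Pi.single i 1 - Pi.single i 1 = f := add_tsub_cancel_right _ _
    have h1 : (0 : ℝ) ≤ (f i : ℝ) + 1 := by positivity
    simp only [annihilation, creation, h, Pi.single_eq_same, Pi.add_apply, mul_one]
    push_cast
    rw [← Complex.ofReal_mul, Real.mul_self_sqrt h1]
    push_cast; rfl
  · have : f + Pi.single i 1 - Pi.single j 1 ≠ f := fun h => by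
      have := congrFun h i; simp [hij] at this
    simp [annihilation, creation, Pi.single_eq_of_ne this]

lemma creation_annihilation_single (f : Fin n → ℕ) (i j : Fin n) :
    creation i (annihilation j (Pi.single f (1 : ℂ))) f = if i = j then (f i : ℂ) else 0 := by
  by_cases h0 : f i = 0
  · simp [creation, h0]
  split_ifs with hij
  · subst hij
    have h := sub_single_add_single h0
    have h1 : ((f i - 1 : ℕ) : ℝ) + 1 = f i := by
      rw [Nat.cast_sub (Nat.one_le_iff_ne_zero.mpr h0)]; simp
    simp only [annihilation, creation, h, Pi.single_eq_same, Pi.sub_apply, mul_one, h1]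
    rw [← Complex.ofReal_mul, Real.mul_self_sqrt (Nat.cast_nonneg _)]
    push_cast; rfl
  · have : f - Pi.single i 1 + Pi.single j 1 ≠ f := fun h => by
      have := congrFun h i; simp [hij] at this; omega
    simp [annihilation, creation, Pi.single_eq_of_ne this]

/-- Only `a a†` and `a† a` on a single mode survive. Position and momentum each yield `((f + 1) + f)
/ 2`, while mixed products are `± i/2` and disappear in the real part. -/
lemma re_quadrature_quadrature_single (f : Fin n → ℕ) (l k : Idx n) :
    (quadrature l (quadrature k (Pi.single f (1 : ℂ))) f).re =
      Matrix.diagonal (Sum.elim (fun i => (f i : ℝ) + 1 / 2) (fun i => (f i : ℝ) + 1 / 2)) l k := by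
  have h2 : (Real.sqrt 2 : ℂ) * (Real.sqrt 2 : ℂ) = 2 := by
    rw [← Complex.ofReal_mul, Real.mul_self_sqrt (by norm_num)]; norm_num
  have h20 : (Real.sqrt 2 : ℂ) ≠ 0 := fun h => by simp [h] at h2
  set c : ℂ := (Real.sqrt 2 : ℂ)⁻¹ with hc
  have hcc : c * c = 1 / 2 := by rw [hc, ← mul_inv, h2]; norm_num
  have hx : ∀ i (ψ : (Fin n → ℕ) → ℂ), quadrature (Sum.inl i) ψ =
      fun m => c * annihilation i ψ m + c * creation i ψ m := fun i ψ => by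
    funext m; simp only [quadrature, div_eq_mul_inv, ← hc]; ring
  have hp : ∀ i (ψ : (Fin n → ℕ) → ℂ), quadrature (Sum.inr i) ψ =
      fun m => (-Complex.I * c) * annihilation i ψ m + (Complex.I * c) * creation i ψ m :=
    fun i ψ => by
      funext m; simp only [quadrature, div_eq_mul_inv, ← hc]; ring
  have aa := annihilation_annihilation_single f
  have cc := creation_creation_single f
  have ac := annihilation_creation_single f
  have ca := creation_annihilation_single f
  rcases l with i | i <;> rcases k with j | j <;>
    simp only [hx, hp, annihilation_linear, creation_linear, aa, cc, ac, ca]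
  all_goals by_cases hij : i = j
  all_goals simp only [hij, if_true, if_false, mul_zero, add_zero, zero_add, Complex.zero_re]
  · have : c * (c * ((f j : ℂ) + 1)) + c * (c * (f j : ℂ)) = ((f j + 1 / 2 : ℝ) : ℂ) := by
      push_cast; linear_combination (2 * (f j : ℂ) + 1) * hcc
    rw [this]; simp
  · simp [Matrix.diagonal, hij]
  · have : c * (Complex.I * c * ((f j : ℂ) + 1)) + c * (-Complex.I * c * (f j : ℂ)) =
        ((1 / 2 : ℝ) : ℂ) * Complex.I := by
      push_cast; linear_combination Complex.I * hcc
    rw [this]; simp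
  · simp
  · have : -Complex.I * c * (c * ((f j : ℂ) + 1)) + Complex.I * c * (c * (f j : ℂ)) =
        ((-1 / 2 : ℝ) : ℂ) * Complex.I := by
      push_cast; linear_combination -Complex.I * hcc
    rw [this]; simp
  · simp
  · have : -Complex.I * c * (Complex.I * c * ((f j : ℂ) + 1)) +
        Complex.I * c * (-Complex.I * c * (f j : ℂ)) = ((f j + 1 / 2 : ℝ) : ℂ) := by
      push_cast
      linear_combination (2 * (f j : ℂ) + 1) * hcc -
        (c * c) * (2 * (f j : ℂ) + 1) * Complex.I_mul_I
    rw [this]; simp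
  · simp [Matrix.diagonal, hij]

/-- The covariance matrix of a Gaussian unitary applied to a Fock state. -/
lemma covarianceMatrix_gaussian {S : Matrix (Idx n) (Idx n) ℝ}
    {U : FockSpace n ≃ₗᵢ[ℂ] FockSpace n} (hU : IsGaussianUnitary S U) (f : Fin n → ℕ) :
    covarianceMatrix (U (fock f)) = S * Matrix.diagonal
      (Sum.elim (fun i => (f i : ℝ) + 1 / 2) (fun i => (f i : ℝ) + 1 / 2)) * S.transpose := by
  ext i j
  rw [covarianceMatrix, Matrix.map_apply, momentMatrix_gaussian hU, Complex.re_sum]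
  simp only [Complex.re_ofReal_mul, Complex.re_sum, re_quadrature_quadrature_single]
  rw [Matrix.mul_assoc, Matrix.mul_apply]
  refine Finset.sum_congr rfl fun l _ => ?_
  rw [Matrix.mul_apply]
  congr 1
  exact Finset.sum_congr rfl fun k _ => by rw [Matrix.transpose_apply]; ring

end FockMoments

open Matrix

/-! ### Operator norm estimates for real matrices. -/

section OperatorNorm

/-- Expand in an eigenbasis of `T* T`, whose eigenvalues are the squared singular values; index `0`
carries the largest. -/
lemma norm_le_singularValues_zero {E F : Type*}
    [NormedAddCommGroup E] [InnerProductSpace ℝ E] [FiniteDimensional ℝ E]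
    [NormedAddCommGroup F] [InnerProductSpace ℝ F] [FiniteDimensional ℝ F]
    (T : E →ₗ[ℝ] F) (v : E) : ‖T v‖ ≤ T.singularValues 0 * ‖v‖ := by
  refine le_of_sq_le_sq ?_ (mul_nonneg (T.singularValues_nonneg 0) (norm_nonneg v))
  have hT := T.isSymmetric_adjoint_comp_self
  set b := hT.eigenvectorBasis rfl
  have h1 : ‖T v‖ ^ 2 = inner ℝ v ((LinearMap.adjoint T ∘ₗ T) v) := by
    rw [LinearMap.comp_apply, LinearMap.adjoint_inner_right, real_inner_self_eq_norm_sq]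
  rw [h1, ← b.sum_inner_mul_inner, mul_pow, ← b.sum_sq_norm_inner_right v, Finset.mul_sum]
  refine Finset.sum_le_sum fun i _ => ?_
  have h2 : inner ℝ (b i) ((LinearMap.adjoint T ∘ₗ T) v) =
      hT.eigenvalues rfl i * inner ℝ (b i) v := by
    have := hT.eigenvectorBasis_apply_self_apply rfl v i
    simpa only [OrthonormalBasis.repr_apply_apply, RCLike.ofReal_real_eq_id, id] using this
  rw [h2, ← T.sq_singularValues_fin rfl i, real_inner_comm, Real.norm_eq_abs, sq_abs]
  have h3 : T.singularValues i ^ 2 ≤ T.singularValues 0 ^ 2 :=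
    pow_le_pow_left₀ (T.singularValues_nonneg _) (T.singularValues_antitone (Nat.zero_le _)) 2
  nlinarith [mul_le_mul_of_nonneg_right h3 (sq_nonneg (inner ℝ (b i) v))]

variable {ι : Type*} [Fintype ι] [DecidableEq ι]

lemma l2_opNorm_le_singularValues_zero (A : Matrix ι ι ℝ) :
    ‖A‖ ≤ (toEuclideanLin A).singularValues 0 := by
  rw [cstar_norm_def]
  exact ContinuousLinearMap.opNorm_le_bound _ (LinearMap.singularValues_nonneg _ 0)
    fun v => norm_le_singularValues_zero (toEuclideanLin A) v

lemma l2_opNorm_transpose (A : Matrix ι ι ℝ) : ‖Aᵀ‖ = ‖A‖ := by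
  rw [← conjTranspose_eq_transpose_of_trivial, l2_opNorm_conjTranspose]

lemma l2_opNorm_mul_transpose_self (A : Matrix ι ι ℝ) : ‖A * Aᵀ‖ = ‖A‖ * ‖A‖ := by
  have := l2_opNorm_conjTranspose_mul_self (Aᵀ)
  rwa [conjTranspose_eq_transpose_of_trivial, transpose_transpose, l2_opNorm_transpose] at this

lemma l2_opNorm_diagonal_le {v : ι → ℝ} {c : ℝ} (hc : 0 ≤ c) (h : ∀ i, |v i| ≤ c) :
    ‖(diagonal v : Matrix ι ι ℝ)‖ ≤ c := by
  rw [l2_opNorm_diagonal]; exact (pi_norm_le_iff_of_nonneg hc).mpr h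

lemma l2_opNorm_one_le : ‖(1 : Matrix ι ι ℝ)‖ ≤ 1 := by
  rw [← diagonal_one]; exact l2_opNorm_diagonal_le zero_le_one (by simp)

lemma l2_opNorm_le_one_of_mul_transpose_self {A : Matrix ι ι ℝ} (h : A * Aᵀ = 1) : ‖A‖ ≤ 1 := by
  have h1 := l2_opNorm_mul_transpose_self A
  rw [h] at h1
  nlinarith [l2_opNorm_one_le (ι := ι), norm_nonneg A]

/-- Entrywise domination controls the operator norm up to the square root of the dimension. -/
lemma l2_opNorm_le_sqrt_card_mul {G W : Matrix ι ι ℝ} (h : ∀ i j, |G i j| ≤ |W i j|) :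
    ‖G‖ ≤ √(Fintype.card ι) * ‖W‖ := by
  -- Columns are images of unit vectors, so the Frobenius norm, which is monotone in the entries,
  -- costs only the square root of the dimension.
  have hW : ∀ j, ∑ i, W i j ^ 2 ≤ ‖W‖ ^ 2 := fun j => by
    have h1 := l2_opNorm_mulVec W (EuclideanSpace.single j (1 : ℝ))
    have h2 := pow_le_pow_left₀ (norm_nonneg _) h1 2
    rw [PiLp.norm_single, norm_one, mul_one, EuclideanSpace.norm_sq_eq] at h2
    simpa [EuclideanSpace.single] using h2
  rw [cstar_norm_def]
  refine ContinuousLinearMap.opNorm_le_bound _ (by positivity) fun v => ?_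
  refine le_of_sq_le_sq ?_ (by positivity)
  rw [EuclideanSpace.norm_sq_eq, mul_pow, mul_pow, Real.sq_sqrt (Nat.cast_nonneg _)]
  calc ∑ i, ‖(toEuclideanCLM (n := ι) (𝕜 := ℝ) G v) i‖ ^ 2
      = ∑ i, (∑ j, G i j * v j) ^ 2 := by
        refine Finset.sum_congr rfl fun i _ => ?_
        rw [Real.norm_eq_abs, sq_abs, ofLp_toEuclideanCLM]; rfl
    _ ≤ ∑ i, (∑ j, G i j ^ 2) * ∑ j, v j ^ 2 :=
        Finset.sum_le_sum fun i _ => Finset.sum_mul_sq_le_sq_mul_sq _ _ _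
    _ ≤ ∑ i, (∑ j, W i j ^ 2) * ∑ j, v j ^ 2 := by
        gcongr ∑ i, (∑ j, ?_) * _ with i _ j
        exact sq_le_sq.mpr (h i j)
    _ = (∑ j, ∑ i, W i j ^ 2) * ‖v‖ ^ 2 := by
        rw [← Finset.sum_mul, Finset.sum_comm, EuclideanSpace.norm_sq_eq]
        simp only [Real.norm_eq_abs, sq_abs]
    _ ≤ (∑ _j : ι, ‖W‖ ^ 2) * ‖v‖ ^ 2 := by
        gcongr with j; exact hW j
    _ = Fintype.card ι * ‖W‖ ^ 2 * ‖v‖ ^ 2 := by simp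

/-- Factor `P² - 1 = (P + 1)(P - 1)`; positivity of `P` means that `P + 1` never shrinks a vector.
-/
lemma l2_opNorm_sub_one_le_of_posSemidef {P : Matrix ι ι ℝ} (hP : P.PosSemidef) :
    ‖P - 1‖ ≤ ‖P * P - 1‖ := by
  have hfac : P * P - 1 = (P + 1) * (P - 1) := by noncomm_ring
  rw [cstar_norm_def (P - 1)]
  refine ContinuousLinearMap.opNorm_le_bound _ (norm_nonneg _) fun v => ?_
  set w := toEuclideanCLM (n := ι) (𝕜 := ℝ) (P - 1) v with hw
  set L := toEuclideanCLM (n := ι) (𝕜 := ℝ) P with hL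
  have h1 : toEuclideanCLM (n := ι) (𝕜 := ℝ) (P * P - 1) v = L w + w := by
    rw [hfac, map_mul, map_add, map_one]; rfl
  have h2 : ‖w‖ ≤ ‖L w + w‖ := by
    refine le_of_sq_le_sq ?_ (norm_nonneg _)
    have h3 : 0 ≤ inner ℝ (L w) w := by
      rw [real_inner_comm, hL, inner_toEuclideanCLM]
      simpa using hP.dotProduct_mulVec_nonneg w.ofLp
    rw [norm_add_sq_real]
    nlinarith [sq_nonneg ‖L w‖]
  calc ‖w‖ ≤ ‖L w + w‖ := h2
    _ = ‖toEuclideanCLM (n := ι) (𝕜 := ℝ) (P * P - 1) v‖ := by rw [h1]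
    _ ≤ ‖P * P - 1‖ * ‖v‖ := by
      rw [cstar_norm_def]; exact ContinuousLinearMap.le_opNorm _ _

end OperatorNorm

/-! ### Symplectic matrices: polar factor, near-intertwining and symplectic spectrum. -/

section Symplectic

variable {n : ℕ}

lemma J_mul_J : J (Fin n) ℝ * J (Fin n) ℝ = -1 := J_squared _ _

lemma l2_opNorm_J_le : ‖J (Fin n) ℝ‖ ≤ 1 :=
  l2_opNorm_le_one_of_mul_transpose_self (by rw [J_transpose, mul_neg, J_mul_J, neg_neg])

lemma isUnit_det_of_symplectic {T : Matrix (Idx n) (Idx n) ℝ}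
    (hT : T ∈ symplecticGroup (Fin n) ℝ) : IsUnit T.det :=
  SymplecticGroup.symplectic_det hT

lemma inv_mem_symplecticGroup {T : Matrix (Idx n) (Idx n) ℝ}
    (hT : T ∈ symplecticGroup (Fin n) ℝ) : T⁻¹ ∈ symplecticGroup (Fin n) ℝ := by
  have := (⟨T, hT⟩⁻¹ : symplecticGroup (Fin n) ℝ).2
  rwa [SymplecticGroup.coe_inv'] at this

/-- The inverse is `-J Tᵀ J` and `J` is a contraction. -/
lemma l2_opNorm_inv_le_of_symplectic {T : Matrix (Idx n) (Idx n) ℝ}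
    (hT : T ∈ symplecticGroup (Fin n) ℝ) : ‖T⁻¹‖ ≤ ‖T‖ := by
  rw [SymplecticGroup.inv_eq_symplectic_inv T hT]
  have hJ := l2_opNorm_J_le (n := n)
  have hJ0 := norm_nonneg (J (Fin n) ℝ)
  calc ‖-J (Fin n) ℝ * Tᵀ * J (Fin n) ℝ‖ ≤ ‖-J (Fin n) ℝ * Tᵀ‖ * ‖J (Fin n) ℝ‖ := norm_mul_le _ _
    _ ≤ (‖-J (Fin n) ℝ‖ * ‖Tᵀ‖) * ‖J (Fin n) ℝ‖ := by gcongr; exact norm_mul_le _ _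
    _ ≤ (1 * ‖Tᵀ‖) * 1 := by rw [norm_neg]; gcongr
    _ = ‖T‖ := by rw [l2_opNorm_transpose]; ring

lemma one_le_l2_opNorm_of_symplectic (hn : n ≠ 0) {T : Matrix (Idx n) (Idx n) ℝ}
    (hT : T ∈ symplecticGroup (Fin n) ℝ) : 1 ≤ ‖T‖ := by
  have : Nonempty (Idx n) := ⟨Sum.inl ⟨0, Nat.pos_of_ne_zero hn⟩⟩
  have h1 : ‖(1 : Matrix (Idx n) (Idx n) ℝ)‖ = 1 := by
    rw [← diagonal_one, l2_opNorm_diagonal]; simp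
  have h2 : ‖(1 : Matrix (Idx n) (Idx n) ℝ)‖ ≤ ‖T‖ * ‖T⁻¹‖ := by
    rw [← mul_nonsing_inv T (isUnit_det_of_symplectic hT)]; exact norm_mul_le _ _
  have h3 := l2_opNorm_inv_le_of_symplectic hT
  nlinarith [norm_nonneg T, norm_nonneg T⁻¹]

open scoped MatrixOrder in
/-- The orthogonal polar factor of a symplectic matrix is symplectic, and its distance to the
matrix is controlled by the deviation from orthogonality. -/
lemma exists_orthogonal_symplectic_near {T : Matrix (Idx n) (Idx n) ℝ}
    (hT : T ∈ symplecticGroup (Fin n) ℝ) :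
    ∃ O : Matrix (Idx n) (Idx n) ℝ, O ∈ symplecticGroup (Fin n) ℝ ∧
      O ∈ orthogonalGroup (Idx n) ℝ ∧ ‖T - O‖ ≤ ‖T * Tᵀ - 1‖ := by
  have hTT : (T * Tᵀ).PosSemidef := by
    simpa [conjTranspose_eq_transpose_of_trivial] using posSemidef_self_mul_conjTranspose T
  obtain ⟨P, hP, hPP⟩ : ∃ P : Matrix (Idx n) (Idx n) ℝ, P.PosSemidef ∧ P * P = T * Tᵀ :=
    ⟨CFC.sqrt (T * Tᵀ), (CFC.sqrt_nonneg _).posSemidef, CFC.sqrt_mul_sqrt_self _ hTT.nonneg⟩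
  have hPt : Pᵀ = P := by
    rw [← conjTranspose_eq_transpose_of_trivial]; exact hP.isHermitian
  have hdet : IsUnit P.det := by
    have h := congrArg det hPP
    rw [det_mul, det_mul, det_transpose] at h
    exact isUnit_of_mul_isUnit_left
      (h ▸ (isUnit_det_of_symplectic hT).mul (isUnit_det_of_symplectic hT))
  set K := J (Fin n) ℝ with hK
  have hKK : K * K = -1 := J_mul_J
  have hQ : (-K * P * K).PosSemidef := by
    have := hP.conjTranspose_mul_mul_same K
    rwa [conjTranspose_eq_transpose_of_trivial, J_transpose] at this
  have hTJT : T * K * Tᵀ = K := SymplecticGroup.mem_iff.mp hT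
  have hTJT' : Tᵀ * K * T = K := SymplecticGroup.mem_iff'.mp hT
  have hQQ : (-K * P * K) * (-K * P * K) = P⁻¹ * P⁻¹ := by
    have e1 : (-K * P * K) * (-K * P * K) = -(K * (P * P) * K) := by
      calc (-K * P * K) * (-K * P * K) = K * P * (K * K) * P * K := by noncomm_ring
        _ = _ := by rw [hKK]; noncomm_ring
    have e2 : (P * P) * -(K * (P * P) * K) = 1 := by
      rw [hPP]
      calc T * Tᵀ * -(K * (T * Tᵀ) * K) = -(T * (Tᵀ * K * T) * Tᵀ * K) := by noncomm_ring
        _ = 1 := by rw [hTJT', hTJT, hKK, neg_neg]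
    rw [e1, ← Matrix.mul_inv_rev, inv_eq_right_inv e2]
  -- Both sides are positive semidefinite with the same square, so uniqueness of the square root
  -- applies; this identity is exactly symplecticity of the symmetric factor `P`.
  have hQP : -K * P * K = P⁻¹ :=
    (CFC.mul_self_eq_mul_self_iff _ _ hQ.nonneg hP.inv.nonneg).mp hQQ
  have hPmem : P ∈ symplecticGroup (Fin n) ℝ := by
    rw [SymplecticGroup.mem_iff, hPt]
    have e : P * (-K * P * K) = 1 := by rw [hQP, mul_nonsing_inv P hdet]
    calc P * K * P = P * (-K * P * K) * K := by
          rw [show P * (-K * P * K) * K = -(P * K * P * (K * K)) by noncomm_ring, hKK]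
          noncomm_ring
      _ = K := by rw [e, one_mul]
  have hinvt : (P⁻¹)ᵀ = P⁻¹ := by rw [transpose_nonsing_inv, hPt]
  have hO : (P⁻¹ * T) * (P⁻¹ * T)ᵀ = 1 := by
    rw [transpose_mul, hinvt]
    calc P⁻¹ * T * (Tᵀ * P⁻¹) = P⁻¹ * (T * Tᵀ) * P⁻¹ := by noncomm_ring
      _ = (P⁻¹ * P) * (P * P⁻¹) := by rw [← hPP]; noncomm_ring
      _ = 1 := by rw [mul_nonsing_inv P hdet, nonsing_inv_mul P hdet, one_mul]
  refine ⟨P⁻¹ * T, mul_mem (inv_mem_symplecticGroup hPmem) hT, ?_, ?_⟩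
  · rw [mem_orthogonalGroup_iff]
    exact hO
  · have e : T - P⁻¹ * T = (P - 1) * (P⁻¹ * T) := by
      rw [sub_mul, ← mul_assoc, mul_nonsing_inv P hdet, one_mul, one_mul]
    rw [e, ← hPP]
    calc ‖(P - 1) * (P⁻¹ * T)‖ ≤ ‖P - 1‖ * ‖P⁻¹ * T‖ := norm_mul_le _ _
      _ ≤ ‖P - 1‖ * 1 := by gcongr; exact l2_opNorm_le_one_of_mul_transpose_self hO
      _ ≤ _ := by rw [mul_one]; exact l2_opNorm_sub_one_le_of_posSemidef hP

lemma diagonal_elim_mul_J (D : Fin n → ℝ) :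
    diagonal (Sum.elim D D) * J (Fin n) ℝ = J (Fin n) ℝ * diagonal (Sum.elim D D) := by
  rw [← fromBlocks_diagonal, J, fromBlocks_multiply, fromBlocks_multiply]
  simp

/-- If a symplectic `T` almost conjugates one pair of symplectic diagonal forms into the other,
then it almost intertwines them. -/
lemma l2_opNorm_intertwiner_le {T E : Matrix (Idx n) (Idx n) ℝ} {D D' : Fin n → ℝ}
    (hT : T ∈ symplecticGroup (Fin n) ℝ) (hD : ∀ i, 1 / 2 ≤ D i) (hD' : ∀ i, 1 / 2 ≤ D' i)
    (hE : T * diagonal (Sum.elim D D) * Tᵀ = diagonal (Sum.elim D' D') + E) :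
    ‖T * diagonal (Sum.elim D D) - diagonal (Sum.elim D' D') * T‖ ≤
      √(Fintype.card (Idx n)) *
        ((2 * ‖diagonal (Sum.elim D' D')‖ * ‖E‖ + ‖E‖ ^ 2) * ‖T‖) := by
  set Δ := diagonal (Sum.elim D D) with hΔ
  set Δ' := diagonal (Sum.elim D' D') with hΔ'
  set K := J (Fin n) ℝ with hK
  have hKK : K * K = -1 := J_mul_J
  have hK1 : ‖K‖ ≤ 1 := l2_opNorm_J_le
  have hΔK : Δ * K = K * Δ := diagonal_elim_mul_J D
  have hΔK' : Δ' * K = K * Δ' := diagonal_elim_mul_J D'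
  have hTJT' : Tᵀ * K * T = K := SymplecticGroup.mem_iff'.mp hT
  set Y := Δ' * K * E * K + E * K * Δ' * K + E * K * E * K with hY
  have hYn : ‖Y‖ ≤ 2 * ‖Δ'‖ * ‖E‖ + ‖E‖ ^ 2 := by
    have hb : ∀ A B : Matrix (Idx n) (Idx n) ℝ, ‖A * K * B * K‖ ≤ ‖A‖ * ‖B‖ := fun A B =>
      calc ‖A * K * B * K‖ ≤ ‖A * K * B‖ * ‖K‖ := norm_mul_le _ _
        _ ≤ ‖A‖ * ‖K‖ * ‖B‖ * ‖K‖ := by gcongr; exact norm_mul₃_le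
        _ ≤ ‖A‖ * 1 * ‖B‖ * 1 := by gcongr
        _ = _ := by ring
    calc ‖Y‖ ≤ ‖Δ'‖ * ‖E‖ + ‖E‖ * ‖Δ'‖ + ‖E‖ * ‖E‖ :=
          norm_add₃_le.trans (add_le_add_three (hb _ _) (hb _ _) (hb _ _))
      _ = _ := by ring
  -- Evaluate `(A K)² T` for `A = T Δ Tᵀ = Δ' + E` in two ways: `Tᵀ K T = K` collapses the first
  -- form to `-T Δ²`, and expanding the second gives `-Δ'² T + Y T`.
  have key : T * (Δ * Δ) - Δ' * Δ' * T = -(Y * T) := by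
    have e1 : (T * Δ * Tᵀ) * K * (T * Δ * Tᵀ) * K * T = -(T * (Δ * Δ)) := by
      calc (T * Δ * Tᵀ) * K * (T * Δ * Tᵀ) * K * T
          = T * Δ * (Tᵀ * K * T) * Δ * (Tᵀ * K * T) := by noncomm_ring
        _ = T * Δ * (K * Δ) * K := by rw [hTJT']; noncomm_ring
        _ = T * (Δ * Δ) * (K * K) := by rw [← hΔK]; noncomm_ring
        _ = _ := by rw [hKK]; noncomm_ring
    have e2 : (Δ' + E) * K * (Δ' + E) * K * T = -(Δ' * Δ' * T) + Y * T := by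
      calc (Δ' + E) * K * (Δ' + E) * K * T = Δ' * (K * Δ') * K * T + Y * T := by
            rw [hY]; noncomm_ring
        _ = Δ' * Δ' * (K * K) * T + Y * T := by rw [← hΔK']; noncomm_ring
        _ = _ := by rw [hKK]; noncomm_ring
    rw [hE, e2] at e1
    rw [← neg_neg (T * (Δ * Δ)), ← e1]; abel
  have hent : ∀ i j, |(T * Δ - Δ' * T) i j| ≤ |(Y * T) i j| := fun i j => by
    have h1 := congrFun (congrFun key i) j
    set d := Sum.elim D D
    set d' := Sum.elim D' D'
    have hd : 1 / 2 ≤ d j := by rcases j with j | j <;> exact hD j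
    have hd' : 1 / 2 ≤ d' i := by rcases i with i | i <;> exact hD' i
    rw [hΔ, hΔ', diagonal_mul_diagonal, diagonal_mul_diagonal] at h1
    rw [hΔ, hΔ']
    simp only [Matrix.sub_apply, mul_diagonal, diagonal_mul, Matrix.neg_apply] at h1 ⊢
    -- A difference of squares, entry by entry; the factor `d j + d' i` is at least `1/2 + 1/2 = 1`,
    -- so dropping it loses nothing.
    have h2 : (Y * T) i j = -((T i j * d j - d' i * T i j) * (d j + d' i)) := by
      linear_combination h1
    rw [h2, abs_neg, abs_mul]
    exact le_mul_of_one_le_right (abs_nonneg _) (le_abs.mpr (Or.inl (by linarith)))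
  refine (l2_opNorm_le_sqrt_card_mul hent).trans ?_
  gcongr
  exact (norm_mul_le _ _).trans (by gcongr)

lemma l2_opNorm_mul_transpose_sub_one_le {T E : Matrix (Idx n) (Idx n) ℝ} {D D' : Fin n → ℝ}
    (hT : T ∈ symplecticGroup (Fin n) ℝ) (hD : ∀ i, 1 / 2 ≤ D i) (hD' : ∀ i, 1 / 2 ≤ D' i)
    (hE : T * diagonal (Sum.elim D D) * Tᵀ = diagonal (Sum.elim D' D') + E) :
    ‖T * Tᵀ - 1‖ ≤ 2 * (‖E‖ + √(Fintype.card (Idx n)) *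
        ((2 * ‖diagonal (Sum.elim D' D')‖ * ‖E‖ + ‖E‖ ^ 2) * ‖T‖) * ‖T‖) := by
  have hG := l2_opNorm_intertwiner_le hT hD hD' hE
  set Δ := diagonal (Sum.elim D D) with hΔ
  set Δ' := diagonal (Sum.elim D' D') with hΔ'
  set Δi : Matrix (Idx n) (Idx n) ℝ := diagonal (fun i => (Sum.elim D' D' i)⁻¹) with hΔi
  have hd' : ∀ i, 1 / 2 ≤ Sum.elim D' D' i := fun i => by rcases i with i | i <;> exact hD' i
  have hinv : Δi * Δ' = 1 := by
    rw [hΔi, hΔ', diagonal_mul_diagonal, ← diagonal_one]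
    congr 1; funext i
    exact inv_mul_cancel₀ (by linarith [hd' i])
  have hΔin : ‖Δi‖ ≤ 2 := l2_opNorm_diagonal_le zero_le_two fun i => by
    have h0 : 0 < Sum.elim D' D' i := by linarith [hd' i]
    rw [abs_of_pos (inv_pos.mpr h0)]
    exact (inv_le_comm₀ h0 two_pos).mpr (by linarith [hd' i])
  have e : T * Tᵀ - 1 = Δi * (E - (T * Δ - Δ' * T) * Tᵀ) := by
    rw [sub_mul, hE]
    calc T * Tᵀ - 1 = (Δi * Δ') * (T * Tᵀ) - Δi * Δ' := by rw [hinv, one_mul]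
      _ = _ := by noncomm_ring
  rw [e]
  calc _ ≤ ‖Δi‖ * ‖E - (T * Δ - Δ' * T) * Tᵀ‖ := norm_mul_le _ _
    _ ≤ 2 * (‖E‖ + ‖T * Δ - Δ' * T‖ * ‖Tᵀ‖) := by
        gcongr; exact (norm_sub_le _ _).trans (by gcongr; exact norm_mul_le _ _)
    _ ≤ _ := by rw [l2_opNorm_transpose]; gcongr

/-- Symplectic eigenvalues of a quantum covariance matrix are at least `1 / 2`. -/
lemma half_le_of_isQuantumCovariance {R V : Matrix (Idx n) (Idx n) ℝ} {D : Fin n → ℝ}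
    (hR : R ∈ symplecticGroup (Fin n) ℝ) (hV : IsQuantumCovariance V)
    (h : V = R * diagonal (Sum.elim D D) * Rᵀ) (i : Fin n) : 1 / 2 ≤ D i := by
  have hdet := isUnit_det_of_symplectic hR
  set Q := R⁻¹ with hQ
  have hQmem : Q ∈ symplecticGroup (Fin n) ℝ := inv_mem_symplecticGroup hR
  have hOm : Omega n = -J (Fin n) ℝ := by
    rw [Omega, J, fromBlocks_neg]; simp
  have h1 : Q * V * Qᵀ = diagonal (Sum.elim D D) := by
    have e : Rᵀ * Qᵀ = 1 := by rw [← transpose_mul, nonsing_inv_mul R hdet, transpose_one]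
    rw [h]
    calc Q * (R * diagonal (Sum.elim D D) * Rᵀ) * Qᵀ
        = (Q * R) * diagonal (Sum.elim D D) * (Rᵀ * Qᵀ) := by noncomm_ring
      _ = _ := by rw [e, nonsing_inv_mul R hdet, one_mul, mul_one]
  have h2 : Q * Omega n * Qᵀ = Omega n := by
    rw [hOm, mul_neg, neg_mul, SymplecticGroup.mem_iff.mp hQmem]
  set c := Complex.ofRealHom with hc
  have hmap : ∀ A : Matrix (Idx n) (Idx n) ℝ, A.map Complex.ofReal = c.mapMatrix A := fun _ => rfl
  have hct : (c.mapMatrix Q)ᴴ = c.mapMatrix Qᵀ := by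
    ext a b; simp [hc, conjTranspose_apply]
  have h3 := hV.2.mul_mul_conjTranspose_same (c.mapMatrix Q)
  rw [hct, hmap, hmap, mul_add, add_mul, mul_smul_comm, smul_mul_assoc, ← map_mul, ← map_mul,
    ← map_mul, ← map_mul, h1, h2] at h3
  -- Conjugation by `R⁻¹` preserves `Ω`. The vector `e_x + i e_p` of mode `i` lies in an eigenspace
  -- of `(i/2) Ω` for `-1/2`, so it yields `2 D i - 1`.
  have h4 := h3.dotProduct_mulVec_nonneg
    (Pi.single (Sum.inl i) 1 + Pi.single (Sum.inr i) Complex.I)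
  have h5 : (0 : ℂ) ≤ 2 * (D i : ℂ) - 1 := by
    refine h4.trans_eq ?_
    simp only [star_add, mulVec_add, dotProduct_add, add_dotProduct, Pi.star_single, star_one,
      single_dotProduct, mulVec_single]
    simp [Omega, hc, one_apply]
    ring_nf
    simp
    ring
  have h6 : (0 : ℂ) ≤ ((2 * D i - 1 : ℝ) : ℂ) := by push_cast; exact h5
  have h7 := Complex.zero_le_real.mp h6
  linarith

/-- With `q` the square root of the diagonal form, `V = (R q)(R q)ᵀ`, and undoing `q` costs at most
`√2` because its entries are at least `1/√2`. -/
lemma l2_opNorm_sq_le_of_diagonalizes {R V : Matrix (Idx n) (Idx n) ℝ} {D : Fin n → ℝ}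
    (hD : ∀ i, 1 / 2 ≤ D i) (h : V = R * diagonal (Sum.elim D D) * Rᵀ) :
    ‖R‖ ^ 2 ≤ 2 * ‖V‖ := by
  have hd : ∀ i, 1 / 2 ≤ Sum.elim D D i := fun i => by rcases i with i | i <;> exact hD i
  have hd0 : ∀ i, 0 < Sum.elim D D i := fun i => by linarith [hd i]
  set q : Matrix (Idx n) (Idx n) ℝ := diagonal (fun i => √(Sum.elim D D i)) with hq
  set qi : Matrix (Idx n) (Idx n) ℝ := diagonal (fun i => (√(Sum.elim D D i))⁻¹) with hqi
  have hqt : qᵀ = q := diagonal_transpose _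
  have hqq : q * q = diagonal (Sum.elim D D) := by
    rw [hq, diagonal_mul_diagonal]; congr 1; funext i
    exact Real.mul_self_sqrt (hd0 i).le
  have hqqi : q * qi = 1 := by
    rw [hq, hqi, diagonal_mul_diagonal, ← diagonal_one]; congr 1; funext i
    exact mul_inv_cancel₀ (Real.sqrt_ne_zero'.mpr (hd0 i))
  have hqin : ‖qi‖ ≤ √2 := l2_opNorm_diagonal_le (Real.sqrt_nonneg _) fun i => by
    rw [← Real.sqrt_inv, abs_of_nonneg (Real.sqrt_nonneg _)]
    exact Real.sqrt_le_sqrt ((inv_le_comm₀ (hd0 i) two_pos).mpr (by linarith [hd i]))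
  have hV : ‖V‖ = ‖R * q‖ * ‖R * q‖ := by
    rw [← l2_opNorm_mul_transpose_self, transpose_mul, hqt, h, ← hqq]
    congr 1; noncomm_ring
  have hR : ‖R‖ ≤ ‖R * q‖ * √2 := by
    calc ‖R‖ = ‖(R * q) * qi‖ := by rw [mul_assoc, hqqi, mul_one]
      _ ≤ ‖R * q‖ * ‖qi‖ := norm_mul_le _ _
      _ ≤ _ := by gcongr
  calc ‖R‖ ^ 2 ≤ (‖R * q‖ * √2) ^ 2 := by gcongr
    _ = 2 * ‖V‖ := by rw [hV, mul_pow, Real.sq_sqrt zero_le_two]; ring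

end Symplectic

/-! ### Quantitative estimate and conclusion. -/

variable {n : ℕ}

lemma l2_opNorm_le_exp_maxSqueezing (hn : n ≠ 0) {S : Matrix (Idx n) (Idx n) ℝ}
    (hS : S ∈ symplecticGroup (Fin n) ℝ) : ‖S‖ ≤ Real.exp (maxSqueezing S) := by
  have h1 := l2_opNorm_le_singularValues_zero S
  have h2 := one_le_l2_opNorm_of_symplectic hn hS
  rw [maxSqueezing, Real.exp_log (by linarith)]
  exact h1

/-- Arithmetic of the small-perturbation case, with `y = ε^(1/8)`, `e = ‖E‖`, `d = ‖Δ'‖`, `t = ‖T‖`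
and `r = √(2n)`. With `k = a b`, the leading term is `k^10 y^8 N = k^3 y N (k y)^7`, and `hc` forces
`k y ≤ 1/8`. -/
lemma perturbation_bound {a b y N e d t r : ℝ} (he0 : 0 ≤ e) (hd0 : 0 ≤ d)
    (ha : 1 ≤ a) (hb : 1 ≤ b) (hN : 1 ≤ N) (hy : 0 ≤ y) (hy8 : y ^ 8 ≤ 1 / 4)
    (hc : ¬ 1 ≤ 8 * (y * a ^ 3 * b ^ 2 * N))
    (he : e ≤ 2 * (a * b) ^ 2 * y ^ 8) (hd : d ≤ 2 * (a * b) ^ 4)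
    (ht : t ^ 2 ≤ 2 * (a ^ 2 * b) ^ 2) (hr : r ≤ 2 * N) :
    2 * (e + r * ((2 * d * e + e ^ 2) * t ^ 2)) ≤ 24 * y * a ^ 5 * b ^ 3 * N := by
  have ha0 : 0 ≤ a := by linarith
  have hb0 : 0 ≤ b := by linarith
  have hN0 : 0 ≤ N := by linarith
  have hab : 1 ≤ a * b := one_le_mul_of_one_le_of_one_le ha hb
  have hsmall : a * b * y ≤ 1 / 8 := by
    have h1 : 1 ≤ a ^ 2 * b * N := one_le_mul_of_one_le_of_one_le
      (one_le_mul_of_one_le_of_one_le (one_le_pow₀ ha) hb) hN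
    have h2 : a * b * y * 1 ≤ a * b * y * (a ^ 2 * b * N) :=
      mul_le_mul_of_nonneg_left h1 (by positivity)
    have h3 : a * b * y * (a ^ 2 * b * N) = y * a ^ 3 * b ^ 2 * N := by ring
    linarith
  have ht' : t ^ 2 ≤ 2 * (a * b) ^ 4 := ht.trans <| by
    have h1 : a ^ 4 * b ^ 2 ≤ a ^ 4 * b ^ 4 :=
      mul_le_mul_of_nonneg_left (pow_le_pow_right₀ hb (by norm_num)) (by positivity)
    linarith [show (a ^ 2 * b) ^ 2 = a ^ 4 * b ^ 2 by ring, mul_pow a b 4]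
  have h35 : 24 * (a ^ 3 * b ^ 3 * y * N) ≤ 24 * y * a ^ 5 * b ^ 3 * N := by
    have h1 : a ^ 3 ≤ a ^ 5 := pow_le_pow_right₀ ha (by norm_num)
    calc 24 * (a ^ 3 * b ^ 3 * y * N) = a ^ 3 * (24 * y * b ^ 3 * N) := by ring
      _ ≤ a ^ 5 * (24 * y * b ^ 3 * N) := mul_le_mul_of_nonneg_right h1 (by positivity)
      _ = _ := by ring
  refine le_trans ?_ h35
  rw [← mul_pow]
  clear ht hc h35
  generalize a * b = k at *
  have hk0 : 0 ≤ k := by linarith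
  have hy7 : (k * y) ^ 7 ≤ (1 / 8) ^ 7 := pow_le_pow_left₀ (by positivity) hsmall 7
  have hquad : 2 * d * e + e ^ 2 ≤ 12 * k ^ 6 * y ^ 8 := by
    calc 2 * d * e + e ^ 2
        ≤ 2 * (2 * k ^ 4) * (2 * k ^ 2 * y ^ 8) + (2 * k ^ 2 * y ^ 8) ^ 2 := by gcongr
      _ = 8 * k ^ 6 * y ^ 8 + 4 * (k ^ 4 * y ^ 8) * y ^ 8 := by ring
      _ ≤ 8 * k ^ 6 * y ^ 8 + 4 * (k ^ 6 * y ^ 8) * 1 := by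
          have h1 : k ^ 4 ≤ k ^ 6 := pow_le_pow_right₀ hab (by norm_num)
          have h2 : y ^ 8 ≤ 1 := by linarith
          gcongr
      _ = _ := by ring
  have hkN : 4 * k ^ 2 * y ^ 8 ≤ 4 * (k ^ 10 * y ^ 8 * N) := by
    have h1 : k ^ 2 ≤ k ^ 10 := pow_le_pow_right₀ hab (by norm_num)
    have h2 : k ^ 2 * y ^ 8 * 1 ≤ k ^ 10 * y ^ 8 * N := by gcongr
    linarith
  calc 2 * (e + r * ((2 * d * e + e ^ 2) * t ^ 2))
      ≤ 2 * (2 * k ^ 2 * y ^ 8 + 2 * N * (12 * k ^ 6 * y ^ 8 * (2 * k ^ 4))) := by gcongr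
    _ = 4 * k ^ 2 * y ^ 8 + 96 * (k ^ 10 * y ^ 8 * N) := by ring
    _ ≤ 100 * (k ^ 10 * y ^ 8 * N) := by linarith
    _ = 100 * (k ^ 3 * y * N) * (k * y) ^ 7 := by ring
    _ ≤ 100 * (k ^ 3 * y * N) * (1 / 8) ^ 7 := by gcongr
    _ ≤ 24 * (k ^ 3 * y * N) := by
        have : 0 ≤ k ^ 3 * y * N := by positivity
        linarith

/-- A perturbation of the covariance matrix of a Gaussian transformation `S` with symplectic
spectrum `D` is diagonalized by `S` up to an almost orthogonal factor; here `a` bounds the norm of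
`S` and `b ^ 2 - 1 / 2` bounds the symplectic spectrum. -/
lemma exists_orthogonal_symplectic_near_diagonalization {S M' F R : Matrix (Idx n) (Idx n) ℝ}
    {D D' : Fin n → ℝ} {a b y : ℝ} (hn : n ≠ 0)
    (hS : S ∈ symplecticGroup (Fin n) ℝ) (hR : R ∈ symplecticGroup (Fin n) ℝ)
    (hD : ∀ i, 1 / 2 ≤ D i) (hDb : ∀ i, D i ≤ b ^ 2 - 1 / 2) (hD' : ∀ i, 1 / 2 ≤ D' i)
    (hSa : ‖S‖ ≤ a) (ha : 1 ≤ a) (hb : 1 ≤ b) (hy : 0 ≤ y) (hy8 : y ^ 8 ≤ 1 / 4)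
    (hF : ‖F‖ ≤ 1)
    (hM' : M' = S * diagonal (Sum.elim D D) * Sᵀ + y ^ 8 • F)
    (hRM : M' = R * diagonal (Sum.elim D' D') * Rᵀ) :
    ∃ O : Matrix (Idx n) (Idx n) ℝ, O ∈ symplecticGroup (Fin n) ℝ ∧
      O ∈ orthogonalGroup (Idx n) ℝ ∧ ‖R⁻¹ * S - O‖ ≤ 24 * y * a ^ 5 * b ^ 3 * n := by
  have hN : (1 : ℝ) ≤ n := Nat.one_le_cast.mpr (Nat.one_le_iff_ne_zero.mpr hn)
  set Δ := diagonal (Sum.elim D D) with hΔ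
  set Δ' := diagonal (Sum.elim D' D') with hΔ'
  set Q := R⁻¹ with hQ
  have hRdet := isUnit_det_of_symplectic hR
  have hy80 : 0 ≤ y ^ 8 := by positivity
  have ha0 : 0 ≤ a := by linarith
  have hb0 : 0 ≤ b := by linarith
  have hab : 1 ≤ a * b := one_le_mul_of_one_le_of_one_le ha hb
  have hT : Q * S ∈ symplecticGroup (Fin n) ℝ := mul_mem (inv_mem_symplecticGroup hR) hS
  have hb2 : (0 : ℝ) ≤ b ^ 2 - 1 / 2 := by nlinarith
  have hΔn : ‖Δ‖ ≤ b ^ 2 - 1 / 2 := l2_opNorm_diagonal_le hb2 fun i => by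
    rcases i with i | i
    all_goals
      have h1 := hD i
      rw [abs_of_nonneg (by simp only [Sum.elim_inl, Sum.elim_inr]; linarith)]
      exact hDb i
  have hMn : ‖M'‖ ≤ a ^ 2 * b ^ 2 := by
    have h1 : ‖S * Δ * Sᵀ‖ ≤ a * (b ^ 2 - 1 / 2) * a :=
      norm_mul₃_le.trans (by rw [l2_opNorm_transpose]; gcongr)
    have h2 : ‖y ^ 8 • F‖ ≤ 1 / 4 := by
      rw [norm_smul, Real.norm_of_nonneg hy80]
      nlinarith [norm_nonneg F]
    calc ‖M'‖ ≤ a * (b ^ 2 - 1 / 2) * a + 1 / 4 := by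
          rw [hM']; exact (norm_add_le _ _).trans (add_le_add h1 h2)
      -- The `1/2` subtracted from `b²` leaves room for the perturbation, since `1/4 ≤ a²/2`.
      _ ≤ _ := by nlinarith
  have hRn : ‖R‖ ^ 2 ≤ 2 * (a * b) ^ 2 :=
    (l2_opNorm_sq_le_of_diagonalizes hD' hRM).trans (by rw [mul_pow]; linarith)
  have hQn : ‖Q‖ ^ 2 ≤ 2 * (a * b) ^ 2 :=
    (pow_le_pow_left₀ (norm_nonneg _) (l2_opNorm_inv_le_of_symplectic hR) 2).trans hRn
  have hconj : ∀ A, Q * (R * A * Rᵀ) * Qᵀ = A := fun A => by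
    have e : Rᵀ * Qᵀ = 1 := by rw [← transpose_mul, nonsing_inv_mul R hRdet, transpose_one]
    calc Q * (R * A * Rᵀ) * Qᵀ = (Q * R) * A * (Rᵀ * Qᵀ) := by noncomm_ring
      _ = _ := by rw [e, nonsing_inv_mul R hRdet, one_mul, mul_one]
  have hQQ : ∀ A, ‖Q * A * Qᵀ‖ ≤ 2 * (a * b) ^ 2 * ‖A‖ := fun A =>
    calc ‖Q * A * Qᵀ‖ ≤ ‖Q‖ * ‖A‖ * ‖Qᵀ‖ := norm_mul₃_le
      _ = ‖Q‖ ^ 2 * ‖A‖ := by rw [l2_opNorm_transpose]; ring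
      _ ≤ _ := by gcongr
  have hΔn' : ‖Δ'‖ ≤ 2 * (a * b) ^ 4 := by
    rw [← hconj Δ', ← hRM]
    refine (hQQ M').trans ?_
    calc 2 * (a * b) ^ 2 * ‖M'‖ ≤ 2 * (a * b) ^ 2 * (a ^ 2 * b ^ 2) := by gcongr
      _ = _ := by ring
  set E := -(y ^ 8) • (Q * F * Qᵀ) with hE
  have hEn : ‖E‖ ≤ 2 * (a * b) ^ 2 * y ^ 8 := by
    rw [hE, norm_smul, norm_neg, Real.norm_of_nonneg hy80]
    calc y ^ 8 * ‖Q * F * Qᵀ‖ ≤ y ^ 8 * (2 * (a * b) ^ 2 * 1) := by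
          gcongr; exact (hQQ F).trans (by gcongr)
      _ = _ := by ring
  have hTE : (Q * S) * Δ * (Q * S)ᵀ = Δ' + E := by
    have h1 : Δ' = Q * (S * Δ * Sᵀ + y ^ 8 • F) * Qᵀ := by rw [← hM', hRM, hconj]
    rw [h1, hE, transpose_mul, mul_add, add_mul, mul_smul_comm, smul_mul_assoc, neg_smul]
    noncomm_ring
  have hTn : ‖Q * S‖ ^ 2 ≤ 2 * (a ^ 2 * b) ^ 2 :=
    calc ‖Q * S‖ ^ 2 ≤ (‖Q‖ * ‖S‖) ^ 2 := by gcongr; exact norm_mul_le _ _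
      _ = ‖Q‖ ^ 2 * ‖S‖ ^ 2 := by ring
      _ ≤ 2 * (a * b) ^ 2 * a ^ 2 := by gcongr
      _ = _ := by ring
  -- In the first case `‖T‖ + 1 ≤ 3 a² b`, and multiplying by the quantity in `hc` produces the
  -- constant `24 = 3 · 8`.
  by_cases hc : 1 ≤ 8 * (y * a ^ 3 * b ^ 2 * n)
  · refine ⟨1, one_mem _, one_mem _, ?_⟩
    have h0 : 1 ≤ a ^ 2 * b := one_le_mul_of_one_le_of_one_le (one_le_pow₀ ha) hb
    have h1 : ‖Q * S‖ ≤ 2 * (a ^ 2 * b) :=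
      le_of_sq_le_sq (hTn.trans (by nlinarith)) (by positivity)
    calc ‖Q * S - 1‖ ≤ ‖Q * S‖ + ‖(1 : Matrix (Idx n) (Idx n) ℝ)‖ := norm_sub_le _ _
      _ ≤ 3 * (a ^ 2 * b) * 1 := by linarith [l2_opNorm_one_le (ι := Idx n)]
      _ ≤ 3 * (a ^ 2 * b) * (8 * (y * a ^ 3 * b ^ 2 * n)) := by gcongr
      _ = _ := by ring
  · obtain ⟨O, hO1, hO2, hO3⟩ := exists_orthogonal_symplectic_near hT
    refine ⟨O, hO1, hO2, hO3.trans ((l2_opNorm_mul_transpose_sub_one_le hT hD hD' hTE).trans ?_)⟩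
    have hcard : √(Fintype.card (Idx n)) ≤ 2 * n := by
      rw [Real.sqrt_le_left (by positivity)]
      simp only [Fintype.card_sum, Fintype.card_fin]
      push_cast
      nlinarith
    have hbound := perturbation_bound (norm_nonneg E) (norm_nonneg Δ')
      ha hb hN hy hy8 hc hEn hΔn' hTn hcard
    refine (le_of_eq ?_).trans hbound
    ring

end Bosonic

theorem mainTheorem6 (n : ℕ) (f : Fin n → ℕ)
    (S : Matrix (Bosonic.Idx n) (Bosonic.Idx n) ℝ)
    (hS : S ∈ Matrix.symplecticGroup (Fin n) ℝ)
    (U : Bosonic.FockSpace n ≃ₗᵢ[ℂ] Bosonic.FockSpace n)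
    (hU : Bosonic.IsGaussianUnitary S U)
    (M M' F R' : Matrix (Bosonic.Idx n) (Bosonic.Idx n) ℝ) (ε : ℝ)
    (hM : M = Bosonic.covarianceMatrix (U (Bosonic.fock f)))
    (hε₀ : 0 ≤ ε) (hε : ε < 1 / 4) (hF : ‖F‖ ≤ 1)
    (hM' : M' = M + ε • F) (hcov : Bosonic.IsQuantumCovariance M')
    (hR' : Bosonic.SymplecticallyDiagonalizes R' M') :
    ∃ O : Matrix (Bosonic.Idx n) (Bosonic.Idx n) ℝ,
      O ∈ Matrix.symplecticGroup (Fin n) ℝ ∧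
      O ∈ Matrix.orthogonalGroup (Bosonic.Idx n) ℝ ∧
      ‖R'⁻¹ * S - O‖ ≤
        24 * ε ^ (1 / 8 : ℝ) * Real.exp (21 * Bosonic.maxSqueezing S / 4)
          * (n : ℝ) ^ (3 / 2 : ℝ) * (1 + (Bosonic.maxOccupation f : ℝ)) ^ (3 / 2 : ℝ) := by
  rcases eq_or_ne n 0 with rfl | hn
  · refine ⟨1, one_mem _, one_mem _, ?_⟩
    -- Without modes every matrix is zero.
    rw [Subsingleton.elim (R'⁻¹ * S - 1) 0, norm_zero]
    positivity
  obtain ⟨hR, D', hRM⟩ := hR'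
  have hN : (1 : ℝ) ≤ n := Nat.one_le_cast.mpr (Nat.one_le_iff_ne_zero.mpr hn)
  set s := Bosonic.maxSqueezing S with hs
  have hSa : ‖S‖ ≤ Real.exp s := Bosonic.l2_opNorm_le_exp_maxSqueezing hn hS
  have ha : 1 ≤ Real.exp s := (Bosonic.one_le_l2_opNorm_of_symplectic hn hS).trans hSa
  have hs0 : 0 ≤ s := Real.one_le_exp_iff.mp ha
  set B : ℝ := 1 + (Bosonic.maxOccupation f : ℝ) with hB
  have hB1 : 1 ≤ B := by rw [hB]; simp
  have hy8 : (ε ^ (1 / 8 : ℝ)) ^ 8 = ε := by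
    rw [← Real.rpow_natCast, ← Real.rpow_mul hε₀]; norm_num
  have hb2 : √B ^ 2 = B := Real.sq_sqrt (by linarith)
  have hb3 : √B ^ 3 = B ^ (3 / 2 : ℝ) := by
    rw [Real.sqrt_eq_rpow, ← Real.rpow_natCast, ← Real.rpow_mul (by linarith)]; norm_num
  rw [hM, Bosonic.covarianceMatrix_gaussian hU f] at hM'
  obtain ⟨O, hO1, hO2, hO3⟩ :=
    Bosonic.exists_orthogonal_symplectic_near_diagonalization (D := fun i => (f i : ℝ) + 1 / 2)
      (a := Real.exp s) (b := √B) (y := ε ^ (1 / 8 : ℝ)) hn hS hR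
      (fun i => by have : (0 : ℝ) ≤ f i := Nat.cast_nonneg _; linarith)
      (fun i => by
        have h1 : (f i : ℝ) ≤ Bosonic.maxOccupation f :=
          Nat.cast_le.mpr (Finset.le_sup (f := f) (Finset.mem_univ i))
        rw [hb2, hB]; linarith)
      (Bosonic.half_le_of_isQuantumCovariance hR hcov hRM) hSa ha (Real.one_le_sqrt.mpr hB1)
      (Real.rpow_nonneg hε₀ _) (by rw [hy8]; exact hε.le) hF (by rw [hy8]; exact hM') hRM
  refine ⟨O, hO1, hO2, hO3.trans ?_⟩
  -- The estimate obtained, with `e^(5s)` and `n`, is sharper than required; `s ≥ 0` and `n ≥ 1`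
  -- allow the exponents to be raised.
  have h5 : Real.exp s ^ 5 ≤ Real.exp (21 * s / 4) := by
    rw [← Real.exp_nat_mul]; exact Real.exp_le_exp.mpr (by push_cast; linarith)
  have hn32 : (n : ℝ) ≤ (n : ℝ) ^ (3 / 2 : ℝ) := by
    simpa using Real.rpow_le_rpow_of_exponent_le hN (show (1 : ℝ) ≤ 3 / 2 by norm_num)
  calc 24 * ε ^ (1 / 8 : ℝ) * Real.exp s ^ 5 * √B ^ 3 * n
      = 24 * ε ^ (1 / 8 : ℝ) * Real.exp s ^ 5 * n * B ^ (3 / 2 : ℝ) := by rw [hb3]; ring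
    _ ≤ _ := by gcongr
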